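/- Let $\lambda>0$. The free Poisson law with parameter $\lambda$ is the probability law on $\mathbb R$ with moments of all orders whose free cumulants $c_1,c_2,\dots$ are all equal to $\lambda$; by the free moment–cumulant formula $m_n=\sum_{\pi\in\mathcal{NC}(n)}\prod_{b\in\pi}c_{\#b}$, its moments are $m_n(\lambda)=\sum_{\pi\in\mathcal{NC}(n)}\lambda^{\#\pi}$, where $\mathcal{NC}(n)$ is the set of noncrossing partitions of $\{1,\dots,n\}$ and $\#\pi$ is the number of blocks of $\pi$. Its classical cumulants $k_n(\lambda)$, $n\ge 1$, are defined by the identity of formal power series $$\sum_{n\ge 1}k_n(\lambda)\frac{z^n}{n!}=\log\Bigl(\sum_{n\ge 0}m_n(\lambda)\frac{z^n}{n!}\Bigr).$$ Two distinct blocks of a set partition of $\{1,\dots,n\}$ cross if there are $i<k<j<l$ with $i,j$ in one of them and $k,l$ in the other; a partition is noncrossing if no two of its blocks cross. Let $G(\pi)$ be the graph whose vertices are the blocks of $\pi$, two distinct blocks being adjacent when they cross. A partition $\pi$ of $\{1,\dots,n\}$ is connected if no nonempty interval $\{a,a+1,\dots,b\}\neq\{1,\dots,n\}$ is a union of blocks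 of $\pi$; let $\mathcal P^c(n)$ be the set of connected partitions of $\{1,\dots,n\}$. For a finite graph $G=(V,E)$ let $$T_G(x,y)=\sum_{A\subseteq E}(x-1)^{c(A)-c(E)}(y-1)^{\#A+c(A)-\#V}$$ be its Tutte polynomial, where $c(A)$ is the number of connected components of $(V,A)$. Then for every $n\ge 1$, $$k_n(\lambda)=-\sum_{\pi\in\mathcal P^c(n)}(-\lambda)^{\#\pi}\,T_{G(\pi)}(1,0).$$ -/

import Mathlib

open MeasureTheory

/-- The set partitions of `{1, …, n}`. -/
abbrev SetPartition (n : ℕ) : Type := Finpartition (Finset.Icc 1 n)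

/-- Two sets of integers cross: there are `i < k < j < l` with `i, j` in one of them and
`k, l` in the other. -/
def BlocksCross (b c : Finset ℕ) : Prop :=
  ∃ i k j l : ℕ, i < k ∧ k < j ∧ j < l ∧
    ((i ∈ b ∧ j ∈ b ∧ k ∈ c ∧ l ∈ c) ∨ (i ∈ c ∧ j ∈ c ∧ k ∈ b ∧ l ∈ b))

theorem BlocksCross.symm {b c : Finset ℕ} (h : BlocksCross b c) : BlocksCross c b := by
  obtain ⟨i, k, j, l, h1, h2, h3, h4⟩ := h
  exact ⟨i, k, j, l, h1, h2, h3, h4.symm⟩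

/-- A partition of a finite set of integers is noncrossing if no two distinct blocks cross. -/
def IsNoncrossing {V : Finset ℕ} (π : Finpartition V) : Prop :=
  ∀ b ∈ π.parts, ∀ c ∈ π.parts, b ≠ c → ¬ BlocksCross b c

/-- A partition of `{1, …, n}` is connected if no (nonempty) interval `{a, …, b}` other than
`{1, …, n}` itself is a union of blocks. -/
def IsConnectedPartition {n : ℕ} (π : SetPartition n) : Prop :=
  ∀ a b : ℕ, 1 ≤ a → a ≤ b → b ≤ n → Finset.Icc a b ≠ Finset.Icc 1 n →
    ¬ ∃ S ⊆ π.parts, S.sup id = Finset.Icc a b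

/-- The crossing graph: the vertices are the blocks, and two distinct blocks are adjacent
when they cross. -/
def crossingGraph {V : Finset ℕ} (π : Finpartition V) : SimpleGraph {b // b ∈ π.parts} where
  Adj b c := b ≠ c ∧ BlocksCross b.1 c.1
  symm := ⟨fun _ _ h => ⟨h.1.symm, h.2.symm⟩⟩
  loopless := ⟨fun _ h => h.1 rfl⟩

/-- The number of connected components of the spanning graph on `V` with edge set `A`. -/
noncomputable def numComponents {V : Type*} (A : Set (Sym2 V)) : ℕ :=
  Nat.card (SimpleGraph.fromEdgeSet A).ConnectedComponent

open Classical in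
/-- The Tutte polynomial `T_G(x, y)` of a finite graph, as a polynomial in `x = X 0` and
`y = X 1`:
`∑_{A ⊆ E} (x - 1) ^ (c(A) - c(E)) * (y - 1) ^ (#A + c(A) - #V)`,
where `c` counts connected components.  The subtractions in the exponents never truncate. -/
noncomputable def tuttePolynomial {V : Type*} [Fintype V] (G : SimpleGraph V) :
    MvPolynomial (Fin 2) ℤ :=
  ∑ A ∈ G.edgeFinset.powerset,
    (MvPolynomial.X 0 - 1) ^ (numComponents (A : Set (Sym2 V)) - numComponents G.edgeSet) *
      (MvPolynomial.X 1 - 1) ^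
        (A.card + numComponents (A : Set (Sym2 V)) - Fintype.card V)

/-- The value `T_G(x, y)` of the Tutte polynomial at real numbers. -/
noncomputable def tutteEval {V : Type*} [Fintype V] (G : SimpleGraph V) (x y : ℝ) : ℝ :=
  MvPolynomial.aeval ![x, y] (tuttePolynomial G)

/-- The classical cumulants `k_n` of a moment sequence `m` (with `m 0 = 1`), defined by
`∑_{n ≥ 1} k_n z^n / n! = log (∑_{n ≥ 0} m_n z^n / n!)` as formal power series. -/
noncomputable def classicalCumulant (m : ℕ → ℝ) (n : ℕ) : ℝ :=
  (n.factorial : ℝ) *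
    PowerSeries.coeff n
      (PowerSeries.logOf (PowerSeries.mk fun k => m k / (k.factorial : ℝ)))

open Classical in
/-- The moment sequence with free cumulants `c`, by the free moment-cumulant formula
`m_n = ∑_{π ∈ NC(n)} ∏_{b ∈ π} c_{#b}`. -/
noncomputable def momentOfFreeCumulants (c : ℕ → ℝ) (n : ℕ) : ℝ :=
  ∑ π : SetPartition n with IsNoncrossing π, ∏ b ∈ π.parts, c b.card

/-- The numbers `c_1, c_2, …` are the free cumulants of the moment sequence `m`. -/
def HasFreeCumulants (m c : ℕ → ℝ) : Prop :=
  ∀ n, m n = momentOfFreeCumulants c n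

/-- The moments of the free Poisson law with parameter `lam`: all free cumulants are `lam`. -/
noncomputable def freePoissonMoment (lam : ℝ) : ℕ → ℝ :=
  momentOfFreeCumulants fun _ => lam

/-- The probability measure `μ` on the line is the free Poisson law with parameter `lam`: it has
moments of all orders, and all its free cumulants are equal to `lam`. -/
structure IsFreePoisson (lam : ℝ) (μ : Measure ℝ) : Prop where
  isProbabilityMeasure : IsProbabilityMeasure μ
  integrable_pow : ∀ n : ℕ, Integrable (fun x : ℝ => x ^ n) μ
  hasFreeCumulants : HasFreeCumulants (fun n => ∫ x, x ^ n ∂μ) fun _ => lam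

/-! The alternating sum of (-1)^#A over all edge sets A of a finite graph is 1 if the graph has no
edges and 0 otherwise (`edgeSum_eq`). Applied to crossing graphs, it turns the sum over noncrossing
partitions into a sum over all partitions P, each carrying a signed edge set A of its crossing
graph.

Fix s in S and split off the component of (P, A) that contains the block of s. If T is the union of
the blocks in that component, this gives N(S) = ∑_{s ∈ T ⊆ S} C(T) N(S \ T), where N is
`noncrossingSum` and C counts only connected spanning edge sets (`noncrossingSum_eq_sum`). Since
crossing depends only on relative order, N(S) is the free Poisson moment of order #S. Grouped by #T,
the identity is the recursion M' = (log M)' M between moments and classical cumulants, so C(S) is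
the cumulant of order #S by induction (`connectedSum_eq_classicalCumulant`).

It remains to evaluate C on {1, …, n}. For a connected graph, T(1, 0) is the signed count of
connected spanning edge sets, up to sign (`tutteEval_one_zero`). The crossing graph of a connected
partition is connected (`IsConnectedPartition.connected`), while a partition that is not connected
has no connected spanning edge set and contributes 0. -/

open Classical in
/-- The edges of `G` with both ends in `P`. -/
noncomputable def edgesIn {α : Type*} (G : SimpleGraph α) (P : Finset α) : Finset (Sym2 α) :=
  P.sym2.filter (· ∈ G.edgeSet)

/-- Any two vertices of `P` are joined by a path with edges in `A`. -/
def Spans {α : Type*} (A : Finset (Sym2 α)) (P : Finset α) : Prop :=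
  ∀ x ∈ P, ∀ y ∈ P, (SimpleGraph.fromEdgeSet (A : Set (Sym2 α))).Reachable x y

open Classical in
/-- The signed count of the connected spanning subgraphs of the graph induced by `G` on `P`. -/
noncomputable def connSum {α : Type*} (G : SimpleGraph α) (P : Finset α) : ℝ :=
  ∑ A ∈ (edgesIn G P).powerset with Spans A P, (-1) ^ A.card

/-- The signed count of all spanning subgraphs of the graph induced by `G` on `P`. -/
noncomputable def edgeSum {α : Type*} (G : SimpleGraph α) (P : Finset α) : ℝ :=
  ∑ A ∈ (edgesIn G P).powerset, (-1) ^ A.card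

/-! ### Signed counts of spanning subgraphs and their connected components -/

section Graph

variable {α : Type*} {G : SimpleGraph α} {P U : Finset α}

theorem mem_edgesIn {x y : α} : s(x, y) ∈ edgesIn G P ↔ x ∈ P ∧ y ∈ P ∧ G.Adj x y := by
  simp [edgesIn, and_assoc]

theorem edgesIn_mono (h : U ⊆ P) : edgesIn G U ⊆ edgesIn G P := by
  intro e
  induction e with
  | h x y =>
    simp only [mem_edgesIn]
    exact fun ⟨hx, hy, ha⟩ => ⟨h hx, h hy, ha⟩

/-- Subsets of a nonempty edge set cancel in pairs of opposite parity. For blocks and crossings this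
is the indicator of being noncrossing. -/
theorem edgeSum_eq (G : SimpleGraph α) (P : Finset α) [Decidable (edgesIn G P = ∅)] :
    edgeSum G P = if edgesIn G P = ∅ then 1 else 0 := by
  classical
  have h := congrArg (Int.cast : ℤ → ℝ)
    (Finset.sum_powerset_neg_one_pow_card (x := edgesIn G P))
  push_cast at h
  rw [edgeSum, h]

theorem edgesIn_eq_empty_iff :
    edgesIn G P = ∅ ↔ ∀ x ∈ P, ∀ y ∈ P, ¬ G.Adj x y := by
  rw [Finset.eq_empty_iff_forall_notMem]
  constructor
  · exact fun h x hx y hy ha => h s(x, y) (mem_edgesIn.2 ⟨hx, hy, ha⟩)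
  · intro h e
    induction e with
    | h x y => exact fun he => h x (mem_edgesIn.1 he).1 y (mem_edgesIn.1 he).2.1 (mem_edgesIn.1 he).2.2

/-- A set of vertices closed under adjacency is closed under reachability. -/
theorem SimpleGraph.Reachable.induct {H : SimpleGraph α} {p : α → Prop} {x y : α}
    (h : H.Reachable x y) (hx : p x) (hp : ∀ a b, p a → H.Adj a b → p b) : p y := by
  obtain ⟨w⟩ := h
  induction w with
  | nil => exact hx
  | cons hab _ ih => exact ih (hp _ _ hx hab)

open Classical in
/-- The vertices of `P` that `A` joins to `v`. -/
noncomputable def reach (A : Finset (Sym2 α)) (P : Finset α) (v : α) : Finset α :=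
  P.filter fun x => (SimpleGraph.fromEdgeSet (A : Set (Sym2 α))).Reachable v x

theorem disjoint_edgesIn_sdiff [DecidableEq α] :
    Disjoint (edgesIn G U) (edgesIn G (P \ U)) := by
  rw [Finset.disjoint_left]
  intro e
  induction e with
  | h x y =>
    simp only [mem_edgesIn, Finset.mem_sdiff]
    tauto

/-- A path in `A` that starts at `v` never leaves the component `U`, so all its edges already lie
inside `U`. -/
theorem spans_inter_of_reach_eq [DecidableEq α] {A : Finset (Sym2 α)} {v : α}
    (hA : A ⊆ edgesIn G P) (hU : reach A P v = U) : Spans (A ∩ edgesIn G U) U := by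
  have hm : ∀ x, x ∈ U ↔ x ∈ P ∧
      (SimpleGraph.fromEdgeSet (A : Set (Sym2 α))).Reachable v x := by
    intro x; rw [← hU]; simp [reach]
  have key : ∀ x ∈ U, (SimpleGraph.fromEdgeSet
      ((A ∩ edgesIn G U : Finset (Sym2 α)) : Set (Sym2 α))).Reachable v x := by
    intro x hx
    refine (SimpleGraph.Reachable.induct (p := fun y =>
      (SimpleGraph.fromEdgeSet (A : Set (Sym2 α))).Reachable v y ∧ (SimpleGraph.fromEdgeSet
      ((A ∩ edgesIn G U : Finset (Sym2 α)) : Set (Sym2 α))).Reachable v y)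
      ((hm x).1 hx).2 ⟨SimpleGraph.Reachable.refl _, SimpleGraph.Reachable.refl _⟩ ?_).2
    rintro a b ⟨h1, h2⟩ hab
    have hA' := mem_edgesIn.1 (hA ((SimpleGraph.fromEdgeSet_adj _).1 hab).1)
    refine ⟨h1.trans hab.reachable, h2.trans (SimpleGraph.Adj.reachable ?_)⟩
    have hab' := (SimpleGraph.fromEdgeSet_adj _).1 hab
    rw [SimpleGraph.fromEdgeSet_adj]
    refine ⟨?_, hab'.2⟩
    rw [Finset.mem_coe, Finset.mem_inter, mem_edgesIn]
    exact ⟨hab'.1, (hm a).2 ⟨hA'.1, h1⟩, (hm b).2 ⟨hA'.2.1, h1.trans hab.reachable⟩, hA'.2.2⟩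
  exact fun x hx y hy => (key x hx).symm.trans (key y hy)

/-- No edge of `A` joins the component `U` to its complement. -/
theorem inter_union_inter_of_reach_eq [DecidableEq α] {A : Finset (Sym2 α)} {v : α}
    (hA : A ⊆ edgesIn G P) (hU : reach A P v = U) :
    (A ∩ edgesIn G U) ∪ (A ∩ edgesIn G (P \ U)) = A := by
  have hm : ∀ x, x ∈ U ↔ x ∈ P ∧
      (SimpleGraph.fromEdgeSet (A : Set (Sym2 α))).Reachable v x := by
    intro x; rw [← hU]; simp [reach]
  ext e
  induction e with
  | h x y =>
    simp only [Finset.mem_union, Finset.mem_inter, mem_edgesIn, Finset.mem_sdiff]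
    refine ⟨fun h => h.elim And.left And.left, fun h => ?_⟩
    have hA' := mem_edgesIn.1 (hA h)
    have hab : (SimpleGraph.fromEdgeSet (A : Set (Sym2 α))).Adj x y := by
      rw [SimpleGraph.fromEdgeSet_adj]
      exact ⟨h, hA'.2.2.ne⟩
    have hxy : x ∈ U ↔ y ∈ U := by
      rw [hm, hm]
      exact ⟨fun h => ⟨hA'.2.1, h.2.trans hab.reachable⟩,
        fun h => ⟨hA'.1, h.2.trans hab.symm.reachable⟩⟩
    tauto

/-- No edge of `A ∪ B` leaves `U`, and `A` alone already connects `U`. This makes restriction to `U`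
and to `P \ U` invertible. -/
theorem reach_union [DecidableEq α] {A B : Finset (Sym2 α)} {v : α} (hUP : U ⊆ P) (hv : v ∈ U)
    (hA : A ⊆ edgesIn G U) (hB : B ⊆ edgesIn G (P \ U)) (hs : Spans A U) :
    reach (A ∪ B) P v = U := by
  ext x
  simp only [reach, Finset.mem_filter]
  constructor
  · rintro ⟨-, h⟩
    refine h.induct (p := fun y => y ∈ U) hv ?_
    intro a b ha hab
    rw [SimpleGraph.fromEdgeSet_adj, Finset.mem_coe, Finset.mem_union] at hab
    rcases hab.1 with h | h
    · exact (mem_edgesIn.1 (hA h)).2.1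
    · exact absurd ha (Finset.mem_sdiff.1 (mem_edgesIn.1 (hB h)).1).2
  · intro hx
    refine ⟨hUP hx, (hs v hv x hx).mono (SimpleGraph.fromEdgeSet_mono ?_)⟩
    exact_mod_cast Finset.subset_union_left

/-- Splitting off the connected component of `v`. -/
theorem edgeSum_eq_sum_connSum [DecidableEq α] (G : SimpleGraph α) {v : α} (hv : v ∈ P) :
    edgeSum G P = ∑ U ∈ P.powerset with v ∈ U, connSum G U * edgeSum G (P \ U) := by
  classical
  have hmaps : ∀ A ∈ (edgesIn G P).powerset, reach A P v ∈ P.powerset.filter (v ∈ ·) := by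
    intro A _
    simp [reach, hv]
  rw [edgeSum, ← Finset.sum_fiberwise_of_maps_to hmaps]
  refine Finset.sum_congr rfl fun U hU => ?_
  obtain ⟨hUP, hvU⟩ : U ⊆ P ∧ v ∈ U := by simpa using hU
  rw [connSum, edgeSum, Finset.sum_mul_sum, ← Finset.sum_product']
  refine Finset.sum_nbij' (fun A => (A ∩ edgesIn G U, A ∩ edgesIn G (P \ U)))
    (fun p => p.1 ∪ p.2) ?_ ?_ ?_ ?_ ?_
  · intro A hA
    simp only [Finset.mem_filter, Finset.mem_powerset] at hA
    simp only [Finset.mem_product, Finset.mem_filter, Finset.mem_powerset]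
    exact ⟨⟨Finset.inter_subset_right, spans_inter_of_reach_eq hA.1 hA.2⟩,
      Finset.inter_subset_right⟩
  · rintro ⟨A, B⟩ h
    simp only [Finset.mem_product, Finset.mem_filter, Finset.mem_powerset] at h
    simp only [Finset.mem_filter, Finset.mem_powerset]
    exact ⟨Finset.union_subset (h.1.1.trans (edgesIn_mono hUP))
      (h.2.trans (edgesIn_mono Finset.sdiff_subset)), reach_union hUP hvU h.1.1 h.2 h.1.2⟩
  · intro A hA
    simp only [Finset.mem_filter, Finset.mem_powerset] at hA
    exact inter_union_inter_of_reach_eq hA.1 hA.2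
  · rintro ⟨A, B⟩ h
    simp only [Finset.mem_product, Finset.mem_filter, Finset.mem_powerset] at h
    have hd := disjoint_edgesIn_sdiff (G := G) (P := P) (U := U)
    have h1 : B ∩ edgesIn G U = ∅ :=
      Finset.disjoint_iff_inter_eq_empty.1 (hd.symm.mono_left h.2)
    have h2 : A ∩ edgesIn G (P \ U) = ∅ :=
      Finset.disjoint_iff_inter_eq_empty.1 (hd.mono_left h.1.1)
    simp [Finset.union_inter_distrib_right, h1, h2, Finset.inter_eq_left.2 h.1.1,
      Finset.inter_eq_left.2 h.2]
  · intro A hA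
    simp only [Finset.mem_filter, Finset.mem_powerset] at hA
    have hd : Disjoint (A ∩ edgesIn G U) (A ∩ edgesIn G (P \ U)) :=
      disjoint_edgesIn_sdiff.mono Finset.inter_subset_right Finset.inter_subset_right
    rw [← pow_add, ← Finset.card_union_of_disjoint hd, inter_union_inter_of_reach_eq hA.1 hA.2]

/-- If the spanning subgraphs cannot be connected, the signed count vanishes. -/
theorem connSum_eq_zero [DecidableEq α] (hU : U ⊆ P) {x y : α} (hx : x ∈ U) (hy : y ∈ P \ U)
    (h : ∀ a ∈ U, ∀ b ∈ P \ U, ¬ G.Adj a b) : connSum G P = 0 := by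
  classical
  rw [connSum, Finset.filter_false_of_mem, Finset.sum_empty]
  intro A hA hs
  rw [Finset.mem_powerset] at hA
  refine (Finset.mem_sdiff.1 hy).2 ((hs x (hU hx) y (Finset.mem_sdiff.1 hy).1).induct
    (p := fun z => z ∈ U) hx ?_)
  intro a b ha hab
  have hab' := mem_edgesIn.1 (hA ((SimpleGraph.fromEdgeSet_adj _).1 hab).1)
  by_contra hb
  exact h a ha b (Finset.mem_sdiff.2 ⟨hab'.2.1, hb⟩) hab'.2.2

open Classical in
/-- The signed count of connected spanning subgraphs in terms of an isomorphic copy. -/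
theorem connSum_map_univ {β : Type*} [Fintype β] (H : SimpleGraph β) (g : β ↪ α)
    (hg : ∀ x y, H.Adj x y ↔ G.Adj (g x) (g y)) :
    connSum G (Finset.univ.map g) = ∑ A ∈ H.edgeFinset.powerset with
      Spans A Finset.univ, (-1) ^ A.card := by
  have hE : edgesIn G (Finset.univ.map g) = H.edgeFinset.map g.sym2Map := by
    ext e
    induction e with
    | h x y =>
      rw [mem_edgesIn]
      constructor
      · rintro ⟨hx, hy, ha⟩
        obtain ⟨x, -, rfl⟩ := Finset.mem_map.1 hx
        obtain ⟨y, -, rfl⟩ := Finset.mem_map.1 hy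
        exact Finset.mem_map.2 ⟨s(x, y), by simpa [hg] using ha, rfl⟩
      · intro h
        obtain ⟨e, he, h⟩ := Finset.mem_map.1 h
        induction e with
        | h a b =>
          have he' : G.Adj (g a) (g b) := by simpa [hg] using he
          have h' : s(g a, g b) = s(x, y) := h
          rcases Sym2.eq_iff.1 h' with ⟨rfl, rfl⟩ | ⟨rfl, rfl⟩
          · simpa using he'
          · simpa using he'.symm
  have hadj : ∀ (A : Finset (Sym2 β)) (x y : β),
      (SimpleGraph.fromEdgeSet ((A.map g.sym2Map : Finset (Sym2 α)) : Set (Sym2 α))).Adj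
        (g x) (g y) ↔ (SimpleGraph.fromEdgeSet (A : Set (Sym2 β))).Adj x y := by
    intro A x y
    rw [SimpleGraph.fromEdgeSet_adj, SimpleGraph.fromEdgeSet_adj, Finset.mem_coe, Finset.mem_coe,
      show s(g x, g y) = g.sym2Map s(x, y) from rfl, Finset.mem_map', g.injective.ne_iff]
  have hspan : ∀ A : Finset (Sym2 β), Spans (A.map g.sym2Map) (Finset.univ.map g) ↔
      Spans A Finset.univ := by
    intro A
    constructor
    · intro h x _ y _
      have hr := h (g x) (by simp) (g y) (by simp)
      -- Every edge of the mapped set has both ends in the range of `g`, so the path lifts vertex by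
      -- vertex.
      obtain ⟨z, hz, hxz⟩ := hr.induct
        (p := fun b => ∃ z, g z = b ∧
          (SimpleGraph.fromEdgeSet (A : Set (Sym2 β))).Reachable x z) ⟨x, rfl, .rfl⟩ (by
          rintro _ b ⟨z, rfl, hz⟩ hab
          have hb := ((SimpleGraph.fromEdgeSet_adj _).1 hab).1
          rw [Finset.mem_coe, Finset.mem_map] at hb
          obtain ⟨e, -, he⟩ := hb
          have : ∃ w, g w = b := by
            induction e with
            | h c d =>
              have h' : s(g c, g d) = s(g z, b) := he
              rcases Sym2.eq_iff.1 h' with ⟨-, h⟩ | ⟨h, -⟩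
              · exact ⟨d, h⟩
              · exact ⟨c, h⟩
          obtain ⟨w, rfl⟩ := this
          exact ⟨w, rfl, hz.trans ((hadj A z w).1 hab).reachable⟩)
      rwa [← g.injective hz]
    · intro h x hx y hy
      obtain ⟨x, -, rfl⟩ := Finset.mem_map.1 hx
      obtain ⟨y, -, rfl⟩ := Finset.mem_map.1 hy
      exact (h x (Finset.mem_univ _) y (Finset.mem_univ _)).map ⟨g, fun {a b} hab => (hadj A a b).2 hab⟩
  rw [connSum, hE]
  symm
  refine Finset.sum_bij (fun A _ => A.map g.sym2Map) ?_ ?_ ?_ ?_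
  · intro A hA
    simp only [Finset.mem_filter, Finset.mem_powerset] at hA ⊢
    exact ⟨Finset.map_subset_map.2 hA.1, (hspan A).2 hA.2⟩
  · intro A _ B _ h
    exact Finset.map_injective _ h
  · intro B hB
    simp only [Finset.mem_filter, Finset.mem_powerset] at hB
    obtain ⟨A, hA, rfl⟩ := Finset.subset_map_iff.1 hB.1
    exact ⟨A, by simpa only [Finset.mem_filter, Finset.mem_powerset] using
      ⟨hA, (hspan A).1 hB.2⟩, rfl⟩
  · intro A _
    rw [Finset.card_map]

/-! ### The Tutte polynomial at (1, 0) -/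

theorem numComponents_eq_one_iff [Fintype α] [Nonempty α] (A : Finset (Sym2 α)) :
    numComponents (A : Set (Sym2 α)) = 1 ↔ Spans A Finset.univ := by
  rw [numComponents, Nat.card_eq_one_iff_unique]
  constructor
  · rintro ⟨h, -⟩ x - y -
    exact SimpleGraph.ConnectedComponent.exact (Subsingleton.elim _ _)
  · intro h
    have h' : (SimpleGraph.fromEdgeSet (A : Set (Sym2 α))).Preconnected :=
      fun x y => h x (Finset.mem_univ _) y (Finset.mem_univ _)
    exact ⟨h'.subsingleton_connectedComponent, inferInstance⟩

open Classical in
theorem tutteEval_one_zero {β : Type*} [Fintype β] (H : SimpleGraph β) (hH : H.Connected) :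
    tutteEval H 1 0 = -(-1) ^ Fintype.card β * ∑ A ∈ H.edgeFinset.powerset with
      Spans A Finset.univ, (-1) ^ A.card := by
  have : Nonempty β := hH.nonempty
  have h1 : numComponents H.edgeSet = 1 := by
    rw [← SimpleGraph.coe_edgeFinset, numComponents_eq_one_iff]
    intro x _ y _
    rw [SimpleGraph.coe_edgeFinset, SimpleGraph.fromEdgeSet_edgeSet]
    exact hH.preconnected x y
  simp only [tutteEval, tuttePolynomial, map_sum, map_mul, map_pow, map_sub, map_one,
    MvPolynomial.aeval_X, h1]
  rw [Finset.mul_sum, Finset.sum_filter]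
  refine Finset.sum_congr rfl fun A hA => ?_
  have hpos : 0 < numComponents (A : Set (Sym2 β)) := Nat.card_pos
  split_ifs with hc
  · have hA1 := (numComponents_eq_one_iff A).2 hc
    have hconn : (SimpleGraph.fromEdgeSet (A : Set (Sym2 β))).Connected :=
      ⟨fun x y => hc x (Finset.mem_univ _) y (Finset.mem_univ _)⟩
    -- A connected graph has at least #V - 1 edges, so the exponent `d` = #A + 1 - #V involves no
    -- truncation and its parity gives the sign.
    have hle := hconn.card_vert_le_card_edgeSet_add_one
    have hcard : Nat.card (SimpleGraph.fromEdgeSet (A : Set (Sym2 β))).edgeSet ≤ A.card := by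
      rw [← Nat.card_eq_finsetCard A]
      refine Nat.card_mono A.finite_toSet ?_
      rw [SimpleGraph.edgeSet_fromEdgeSet]
      exact Set.sdiff_subset
    rw [Nat.card_eq_fintype_card] at hle
    obtain ⟨d, hd⟩ := Nat.exists_eq_add_of_le (hle.trans (Nat.add_le_add_right hcard 1))
    have hA' : (-1 : ℝ) ^ A.card = -((-1) ^ Fintype.card β * (-1) ^ d) := by
      rw [← pow_add, ← hd, pow_succ]
      ring
    rw [hA1, hd, Nat.add_sub_cancel_left, hA']
    have hsq : ((-1 : ℝ) ^ Fintype.card β) * (-1) ^ Fintype.card β = 1 := by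
      rw [← mul_pow]; simp
    simp only [Matrix.cons_val_zero, Matrix.cons_val_one, zero_sub]
    simp only [Nat.sub_self, pow_zero, one_mul]
    linear_combination (-(-1 : ℝ) ^ d) * hsq
  -- At x = 1 the first factor is 0 to this exponent, which kills the disconnected edge sets.
  · have : numComponents (A : Set (Sym2 β)) - 1 ≠ 0 := by
      have := mt (numComponents_eq_one_iff A).1 hc
      omega
    simp [this]

end Graph

/-! ### Partitions as sets of blocks, and the component recursion -/

/-- `P` is the set of blocks of a partition of `S`. -/
def IsPartition (P : Finset (Finset ℕ)) (S : Finset ℕ) : Prop :=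
  (∀ b ∈ P, b.Nonempty ∧ b ⊆ S) ∧ (∀ x ∈ S, ∃ b ∈ P, x ∈ b) ∧
    ∀ b ∈ P, ∀ c ∈ P, ∀ x, x ∈ b → x ∈ c → b = c

open Classical in
/-- The partitions of `S`, as sets of blocks. -/
noncomputable def partitionsOf (S : Finset ℕ) : Finset (Finset (Finset ℕ)) :=
  S.powerset.powerset.filter (IsPartition · S)

/-- The graph on all finite sets of integers in which distinct sets are adjacent when they
cross. -/
def crossGraph : SimpleGraph (Finset ℕ) where
  Adj b c := b ≠ c ∧ BlocksCross b c
  symm := ⟨fun _ _ h => ⟨h.1.symm, h.2.symm⟩⟩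
  loopless := ⟨fun _ h => h.1 rfl⟩

/-- The weighted count of the noncrossing partitions of `S`. -/
noncomputable def noncrossingSum (lam : ℝ) (S : Finset ℕ) : ℝ :=
  ∑ P ∈ partitionsOf S, lam ^ P.card * edgeSum crossGraph P

/-- The weighted count of the partitions of `S` with a connected set of crossings. -/
noncomputable def connectedSum (lam : ℝ) (S : Finset ℕ) : ℝ :=
  ∑ P ∈ partitionsOf S, lam ^ P.card * connSum crossGraph P

theorem mem_partitionsOf {P : Finset (Finset ℕ)} {S : Finset ℕ} :
    P ∈ partitionsOf S ↔ IsPartition P S := by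
  simp only [partitionsOf, Finset.mem_filter, Finset.mem_powerset, and_iff_right_iff_imp]
  exact fun h b hb => Finset.mem_powerset.2 (h.1 b hb).2

namespace IsPartition

variable {P Q U : Finset (Finset ℕ)} {S T : Finset ℕ}

theorem sup_eq (h : IsPartition P S) : P.sup id = S := by
  ext x
  simp only [Finset.mem_sup, id]
  exact ⟨fun ⟨b, hb, hx⟩ => (h.1 b hb).2 hx, h.2.1 x⟩

theorem of_subset (h : IsPartition P S) (hU : U ⊆ P) : IsPartition U (U.sup id) :=
  ⟨fun b hb => ⟨(h.1 b (hU hb)).1, Finset.le_sup (f := id) hb⟩,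
    fun x hx => by simpa [Finset.mem_sup] using hx,
    fun b hb c hc => h.2.2 b (hU hb) c (hU hc)⟩

theorem mem_of_mem_sup (h : IsPartition P S) (hU : U ⊆ P) {b : Finset ℕ} (hb : b ∈ P) {x : ℕ}
    (hx : x ∈ b) (hxU : x ∈ U.sup id) : b ∈ U := by
  obtain ⟨c, hc, hxc⟩ := Finset.mem_sup.1 hxU
  rwa [h.2.2 b hb c (hU hc) x hx hxc]

theorem sdiff [DecidableEq (Finset ℕ)] (h : IsPartition P S) (hU : U ⊆ P) :
    IsPartition (P \ U) (S \ U.sup id) := by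
  refine ⟨fun b hb => ?_, fun x hx => ?_, fun b hb c hc => ?_⟩
  · rw [Finset.mem_sdiff] at hb
    refine ⟨(h.1 b hb.1).1, fun x hx => Finset.mem_sdiff.2 ⟨(h.1 b hb.1).2 hx, fun hxU => ?_⟩⟩
    exact hb.2 (h.mem_of_mem_sup hU hb.1 hx hxU)
  · rw [Finset.mem_sdiff] at hx
    obtain ⟨b, hb, hxb⟩ := h.2.1 x hx.1
    exact ⟨b, Finset.mem_sdiff.2 ⟨hb, fun hbU => hx.2 (Finset.mem_sup.2 ⟨b, hbU, hxb⟩)⟩, hxb⟩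
  · exact h.2.2 b (Finset.mem_sdiff.1 hb).1 c (Finset.mem_sdiff.1 hc).1

theorem union [DecidableEq (Finset ℕ)] (hP : IsPartition P T) (hQ : IsPartition Q (S \ T))
    (hT : T ⊆ S) : IsPartition (P ∪ Q) S := by
  refine ⟨fun b hb => ?_, fun x hx => ?_, fun b hb c hc x hxb hxc => ?_⟩
  · rcases Finset.mem_union.1 hb with h | h
    · exact ⟨(hP.1 b h).1, (hP.1 b h).2.trans hT⟩
    · exact ⟨(hQ.1 b h).1, (hQ.1 b h).2.trans Finset.sdiff_subset⟩
  · by_cases hxT : x ∈ T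
    · obtain ⟨b, hb, hx⟩ := hP.2.1 x hxT
      exact ⟨b, Finset.mem_union_left _ hb, hx⟩
    · obtain ⟨b, hb, hx⟩ := hQ.2.1 x (Finset.mem_sdiff.2 ⟨hx, hxT⟩)
      exact ⟨b, Finset.mem_union_right _ hb, hx⟩
  · rcases Finset.mem_union.1 hb with h | h <;> rcases Finset.mem_union.1 hc with h' | h'
    · exact hP.2.2 b h c h' x hxb hxc
    · exact absurd ((hP.1 b h).2 hxb) (Finset.mem_sdiff.1 ((hQ.1 c h').2 hxc)).2
    · exact absurd ((hP.1 c h').2 hxc) (Finset.mem_sdiff.1 ((hQ.1 b h).2 hxb)).2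
    · exact hQ.2.2 b h c h' x hxb hxc

theorem disjoint (hP : IsPartition P T) (hQ : IsPartition Q (S \ T)) : Disjoint P Q := by
  rw [Finset.disjoint_left]
  intro b hb hb'
  obtain ⟨x, hx⟩ := (hP.1 b hb).1
  exact (Finset.mem_sdiff.1 ((hQ.1 b hb').2 hx)).2 ((hP.1 b hb).2 hx)

end IsPartition

/-- Splitting off the connected component of the block that contains `s`. -/
theorem noncrossingSum_eq_sum (lam : ℝ) {S : Finset ℕ} {s : ℕ} (hs : s ∈ S) :
    noncrossingSum lam S =
      ∑ T ∈ S.powerset with s ∈ T, connectedSum lam T * noncrossingSum lam (S \ T) := by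
  have h1 : noncrossingSum lam S = ∑ P ∈ partitionsOf S, ∑ U ∈ P.powerset with s ∈ U.sup id,
      (lam ^ U.card * connSum crossGraph U) *
        (lam ^ (P \ U).card * edgeSum crossGraph (P \ U)) := by
    refine Finset.sum_congr rfl fun P hP => ?_
    rw [mem_partitionsOf] at hP
    obtain ⟨b, hb, hsb⟩ := hP.2.1 s hs
    rw [edgeSum_eq_sum_connSum crossGraph hb, Finset.mul_sum]
    refine Finset.sum_congr (Finset.filter_congr fun U hU => ?_) fun U hU => ?_
    · rw [Finset.mem_powerset] at hU
      exact ⟨fun h => Finset.mem_sup.2 ⟨b, h, hsb⟩, hP.mem_of_mem_sup hU hb hsb⟩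
    · have hU' : U ⊆ P := Finset.mem_powerset.1 (Finset.mem_filter.1 hU).1
      rw [← Finset.card_sdiff_add_card_eq_card hU', pow_add]
      ring
  rw [h1]
  simp only [noncrossingSum, connectedSum, Finset.sum_mul_sum, ← Finset.sum_product']
  rw [Finset.sum_sigma', Finset.sum_sigma']
  -- A partition of `S` with a chosen subfamily `U` of blocks amounts to the union `T` of `U`, a
  -- partition of `T` and a partition of `S \ T`.
  refine Finset.sum_nbij' (fun p => ⟨p.2.sup id, (p.2, p.1 \ p.2)⟩)
    (fun q => ⟨q.2.1 ∪ q.2.2, q.2.1⟩) ?_ ?_ ?_ ?_ ?_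
  · rintro ⟨P, U⟩ h
    simp only [Finset.mem_sigma, Finset.mem_filter, Finset.mem_powerset, Finset.mem_product,
      mem_partitionsOf] at h ⊢
    refine ⟨⟨?_, h.2.2⟩, h.1.of_subset h.2.1, h.1.sdiff h.2.1⟩
    exact (Finset.sup_mono h.2.1).trans h.1.sup_eq.le
  · rintro ⟨T, P, Q⟩ h
    simp only [Finset.mem_sigma, Finset.mem_filter, Finset.mem_powerset, Finset.mem_product,
      mem_partitionsOf] at h ⊢
    refine ⟨h.2.1.union h.2.2 h.1.1, Finset.subset_union_left, ?_⟩
    rw [h.2.1.sup_eq]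
    exact h.1.2
  · rintro ⟨P, U⟩ h
    simp only [Finset.mem_sigma, Finset.mem_filter, Finset.mem_powerset] at h
    simp only [Finset.union_sdiff_of_subset h.2.1]
  · rintro ⟨T, P, Q⟩ h
    simp only [Finset.mem_sigma, Finset.mem_filter, Finset.mem_powerset, Finset.mem_product,
      mem_partitionsOf] at h
    simp only [h.2.1.sup_eq, Finset.union_sdiff_cancel_left (h.2.1.disjoint h.2.2)]
  · rintro ⟨P, U⟩ h
    rfl

theorem sum_powerset_filter_mem {S : Finset ℕ} {s : ℕ} (hs : s ∈ S) (g : Finset ℕ → ℝ) :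
    ∑ T ∈ S.powerset with s ∈ T, g T = ∑ T ∈ (S.erase s).powerset, g (insert s T) := by
  refine Finset.sum_nbij' (fun T => T.erase s) (fun T => insert s T) ?_ ?_ ?_ ?_ ?_
  · intro T hT
    simp only [Finset.mem_filter, Finset.mem_powerset] at hT ⊢
    exact Finset.erase_subset_erase s hT.1
  · intro T hT
    simp only [Finset.mem_filter, Finset.mem_powerset] at hT ⊢
    exact ⟨Finset.insert_subset hs (hT.trans (Finset.erase_subset _ _)),
      Finset.mem_insert_self _ _⟩
  · intro T hT
    exact Finset.insert_erase (Finset.mem_filter.1 hT).2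
  · intro T hT
    exact Finset.erase_insert fun h =>
      (Finset.mem_erase.1 (Finset.mem_powerset.1 hT h)).1 rfl
  · intro T hT
    rw [Finset.insert_erase (Finset.mem_filter.1 hT).2]

/-! ### Invariance under increasing bijections -/

section Transport

variable {S T : Finset ℕ} {e f : ℕ → ℕ}

theorem image_image_of_leftInvOn (hfe : ∀ x ∈ S, f (e x) = x) {b : Finset ℕ} (hb : b ⊆ S) :
    (b.image e).image f = b := by
  rw [Finset.image_image]
  exact (Finset.image_congr fun x hx => hfe x (hb hx)).trans Finset.image_id'

theorem image_blocks_of_leftInvOn (hfe : ∀ x ∈ S, f (e x) = x) {P : Finset (Finset ℕ)}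
    (hP : IsPartition P S) :
    (P.image (Finset.image e)).image (Finset.image f) = P := by
  rw [Finset.image_image]
  exact (Finset.image_congr fun b hb => image_image_of_leftInvOn hfe (hP.1 b hb).2).trans
    Finset.image_id'

theorem IsPartition.image (he : ∀ x ∈ S, e x ∈ T) (hf : ∀ y ∈ T, f y ∈ S)
    (hfe : ∀ x ∈ S, f (e x) = x) (hef : ∀ y ∈ T, e (f y) = y) {P : Finset (Finset ℕ)}
    (hP : IsPartition P S) : IsPartition (P.image (Finset.image e)) T := by
  refine ⟨fun b' hb' => ?_, fun y hy => ?_, fun b' hb' c' hc' y hyb hyc => ?_⟩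
  · obtain ⟨b, hb, rfl⟩ := Finset.mem_image.1 hb'
    exact ⟨(hP.1 b hb).1.image e, Finset.image_subset_iff.2 fun x hx => he x ((hP.1 b hb).2 hx)⟩
  · obtain ⟨b, hb, hxb⟩ := hP.2.1 _ (hf y hy)
    exact ⟨b.image e, Finset.mem_image_of_mem _ hb,
      Finset.mem_image.2 ⟨f y, hxb, hef y hy⟩⟩
  · obtain ⟨b, hb, rfl⟩ := Finset.mem_image.1 hb'
    obtain ⟨c, hc, rfl⟩ := Finset.mem_image.1 hc'
    obtain ⟨x, hx, rfl⟩ := Finset.mem_image.1 hyb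
    obtain ⟨z, hz, hzx⟩ := Finset.mem_image.1 hyc
    have : z = x := by
      rw [← hfe z ((hP.1 c hc).2 hz), ← hfe x ((hP.1 b hb).2 hx), hzx]
    rw [hP.2.2 b hb c hc x hx (this ▸ hz)]

theorem BlocksCross.image (hmono : ∀ x ∈ S, ∀ y ∈ S, x < y → e x < e y) {b c : Finset ℕ}
    (hb : b ⊆ S) (hc : c ⊆ S) (h : BlocksCross b c) : BlocksCross (b.image e) (c.image e) := by
  obtain ⟨i, k, j, l, h1, h2, h3, h4⟩ := h
  have hm : i ∈ S ∧ k ∈ S ∧ j ∈ S ∧ l ∈ S := by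
    rcases h4 with ⟨hi, hj, hk, hl⟩ | ⟨hi, hj, hk, hl⟩
    · exact ⟨hb hi, hc hk, hb hj, hc hl⟩
    · exact ⟨hc hi, hb hk, hc hj, hb hl⟩
  refine ⟨e i, e k, e j, e l, hmono _ hm.1 _ hm.2.1 h1, hmono _ hm.2.1 _ hm.2.2.1 h2,
    hmono _ hm.2.2.1 _ hm.2.2.2 h3, h4.imp ?_ ?_⟩ <;>
  exact fun h => ⟨Finset.mem_image_of_mem _ h.1, Finset.mem_image_of_mem _ h.2.1,
    Finset.mem_image_of_mem _ h.2.2.1, Finset.mem_image_of_mem _ h.2.2.2⟩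

theorem edgesIn_image_eq_empty (he : ∀ x ∈ S, e x ∈ T)
    (hfe : ∀ x ∈ S, f (e x) = x)
    (hmono : ∀ x ∈ T, ∀ y ∈ T, x < y → f x < f y) {P : Finset (Finset ℕ)}
    (hP : IsPartition P S) (h : edgesIn crossGraph P = ∅) :
    edgesIn crossGraph (P.image (Finset.image e)) = ∅ := by
  rw [edgesIn_eq_empty_iff] at h ⊢
  intro b' hb' c' hc' hbc
  obtain ⟨b, hb, rfl⟩ := Finset.mem_image.1 hb'
  obtain ⟨c, hc, rfl⟩ := Finset.mem_image.1 hc'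
  have hbS := (hP.1 b hb).2
  have hcS := (hP.1 c hc).2
  refine h b hb c hc ⟨fun h => hbc.1 (by rw [h]), ?_⟩
  have := BlocksCross.image (e := f) hmono
    (Finset.image_subset_iff.2 fun x hx => he x (hbS hx))
    (Finset.image_subset_iff.2 fun x hx => he x (hcS hx)) hbc.2
  rwa [image_image_of_leftInvOn hfe hbS, image_image_of_leftInvOn hfe hcS] at this

end Transport

/-- Increasing bijections, mutually inverse, between two sets of the same size. -/
theorem exists_increasing_bijection {S T : Finset ℕ} (h : S.card = T.card) :
    ∃ e f : ℕ → ℕ, (∀ x ∈ S, e x ∈ T) ∧ (∀ y ∈ T, f y ∈ S) ∧ (∀ x ∈ S, f (e x) = x) ∧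
      (∀ y ∈ T, e (f y) = y) ∧ (∀ x ∈ S, ∀ y ∈ S, x < y → e x < e y) ∧
      ∀ x ∈ T, ∀ y ∈ T, x < y → f x < f y := by
  let o : S ≃o T := (S.orderIsoOfFin h).symm.trans (T.orderIsoOfFin rfl)
  refine ⟨fun x => if hx : x ∈ S then o ⟨x, hx⟩ else 0,
    fun y => if hy : y ∈ T then o.symm ⟨y, hy⟩ else 0, ?_, ?_, ?_, ?_, ?_, ?_⟩
  · intro x hx; simp [hx]
  · intro x hx; simp [hx]
  · intro x hx; simp [hx]
  · intro x hx; simp [hx]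
  · intro x hx y hy hxy
    simpa [hx, hy] using hxy
  · intro x hx y hy hxy
    simpa [hx, hy] using hxy

/-- An increasing bijection preserves crossings. As `edgeSum` only detects whether there are any, it
suffices to transport the absence of edges. -/
theorem noncrossingSum_eq_of_card_eq (lam : ℝ) {S T : Finset ℕ} (h : S.card = T.card) :
    noncrossingSum lam S = noncrossingSum lam T := by
  classical
  obtain ⟨e, f, he, hf, hfe, hef, hem, hfm⟩ := exists_increasing_bijection h
  refine Finset.sum_nbij' (fun P => P.image (Finset.image e)) (fun P => P.image (Finset.image f))
    ?_ ?_ ?_ ?_ ?_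
  · intro P hP
    rw [mem_partitionsOf] at hP ⊢
    exact hP.image he hf hfe hef
  · intro P hP
    rw [mem_partitionsOf] at hP ⊢
    exact hP.image hf he hef hfe
  · intro P hP
    exact image_blocks_of_leftInvOn hfe (mem_partitionsOf.1 hP)
  · intro P hP
    exact image_blocks_of_leftInvOn hef (mem_partitionsOf.1 hP)
  · intro P hP
    rw [mem_partitionsOf] at hP
    have hinv := image_blocks_of_leftInvOn hfe hP
    have hcard : (P.image (Finset.image e)).card = P.card := by
      refine le_antisymm Finset.card_image_le ?_
      conv_lhs => rw [← hinv]
      exact Finset.card_image_le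
    have hiff : edgesIn crossGraph P = ∅ ↔
        edgesIn crossGraph (P.image (Finset.image e)) = ∅ := by
      refine ⟨edgesIn_image_eq_empty he hfe hfm hP, fun h => ?_⟩
      have := edgesIn_image_eq_empty hf hef hem (hP.image he hf hfe hef) h
      rwa [hinv] at this
    rw [hcard, edgeSum_eq, edgeSum_eq]
    simp only [hiff]

/-! ### Classical cumulants and the moment recursion -/

-- The derivative of log(1 + X) is the inverse of 1 + X; substituting M - 1 and applying the chain
-- rule gives the logarithmic derivative.
open PowerSeries in
theorem derivative_logOf_mul (M : PowerSeries ℝ) (hM : constantCoeff M = 1) :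
    derivative ℝ (logOf M) * M = derivative ℝ M := by
  have hs : HasSubst (M - 1) := HasSubst.of_constantCoeff_zero' (by simp [hM])
  have hgeom : derivative ℝ (log ℝ) * (1 + X) = 1 := by
    rw [deriv_log]
    ext n
    cases n with
    | zero => simp [mul_add]
    | succ n => simp [mul_add, coeff_succ_mul_X, coeff_one, pow_succ]
  have h1 : (derivative ℝ (log ℝ)).subst (M - 1) * M = 1 := by
    have h := congrArg (substAlgHom (R := ℝ) hs) hgeom
    rw [map_mul, map_add, map_one, substAlgHom_X, coe_substAlgHom] at h
    rwa [add_sub_cancel] at h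
  rw [logOf_eq, derivative_subst hs, map_sub, Derivation.map_one_eq_zero, sub_zero]
  rw [mul_right_comm, h1, one_mul]

/-- The recursion between moments and classical cumulants. -/
theorem moment_succ_eq_sum (m : ℕ → ℝ) (hm : m 0 = 1) (n : ℕ) :
    m (n + 1) = ∑ k ∈ Finset.range (n + 1),
      n.choose k • (classicalCumulant m (k + 1) * m (n - k)) := by
  have h := congrArg (PowerSeries.coeff n) (derivative_logOf_mul
    (PowerSeries.mk fun k => m k / (k.factorial : ℝ)) (by simp [hm]))
  rw [PowerSeries.coeff_mul, PowerSeries.coeff_derivative, PowerSeries.coeff_mk,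
    Finset.Nat.sum_antidiagonal_eq_sum_range_succ_mk] at h
  have hn : (n.factorial : ℝ) ≠ 0 := by positivity
  have h1 : m (n + 1) = n.factorial * (m (n + 1) / ((n + 1).factorial : ℝ) * (n + 1)) := by
    rw [Nat.factorial_succ]
    push_cast
    field_simp
  rw [h1, ← h, Finset.mul_sum]
  refine Finset.sum_congr rfl fun k hk => ?_
  have hkn : k ≤ n := Nat.lt_succ_iff.1 (Finset.mem_range.1 hk)
  rw [PowerSeries.coeff_derivative, PowerSeries.coeff_mk, classicalCumulant, nsmul_eq_mul,
    Nat.cast_choose ℝ hkn, Nat.factorial_succ]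
  have : (k.factorial : ℝ) ≠ 0 := by positivity
  push_cast
  field_simp

/-- The weighted counts of connected partitions are the cumulants of the weighted counts of
noncrossing partitions. -/
theorem connectedSum_eq_classicalCumulant (lam : ℝ) (m : ℕ → ℝ) (hm : m 0 = 1)
    (hN : ∀ S, noncrossingSum lam S = m S.card) (S : Finset ℕ) (hS : S.Nonempty) :
    connectedSum lam S = classicalCumulant m S.card := by
  induction S using Finset.strongInduction with
  | H S ih =>
    obtain ⟨s, hs⟩ := hS
    have hcard : S.card = (S.erase s).card + 1 := (Finset.card_erase_add_one hs).symm
    have h1 := noncrossingSum_eq_sum lam hs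
    rw [sum_powerset_filter_mem hs, hN, hcard, moment_succ_eq_sum m hm,
      -- The binomial coefficients count the subsets of `S.erase s` by size, so both sides become
      -- sums over the same subsets.
      ← Finset.sum_powerset_apply_card
        (fun k => classicalCumulant m (k + 1) * m ((S.erase s).card - k))] at h1
    -- The full subset carries the unknown `connectedSum lam S`; all other terms agree by induction
    -- and cancel.
    rw [← Finset.add_sum_erase _ _ (Finset.mem_powerset_self (S.erase s)),
      ← Finset.add_sum_erase _ _ (Finset.mem_powerset_self (S.erase s))] at h1
    have h2 : ∑ T ∈ (S.erase s).powerset.erase (S.erase s),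
        classicalCumulant m (T.card + 1) * m ((S.erase s).card - T.card) =
        ∑ T ∈ (S.erase s).powerset.erase (S.erase s),
          connectedSum lam (insert s T) * noncrossingSum lam (S \ insert s T) := by
      refine Finset.sum_congr rfl fun T hT => ?_
      rw [Finset.mem_erase, Finset.mem_powerset] at hT
      have hsT : s ∉ T := fun h => (Finset.mem_erase.1 (hT.2 h)).1 rfl
      have hss : insert s T ⊂ S := by
        refine (Finset.insert_subset hs (hT.2.trans (Finset.erase_subset _ _))).ssubset_of_ne ?_
        exact fun h => hT.1 (by rw [← h, Finset.erase_insert hsT])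
      rw [ih _ hss (Finset.insert_nonempty s T), hN, Finset.card_insert_of_notMem hsT,
        Finset.card_sdiff_of_subset hss.subset, Finset.card_insert_of_notMem hsT, hcard,
        Nat.add_sub_add_right]
    rw [h2, Finset.insert_erase hs, hN (S \ S)] at h1
    simpa [hm, hcard] using (add_right_cancel h1).symm

/-! ### Free Poisson moments as weighted noncrossing counts -/

/-- The set of blocks of a partition of `S`. -/
theorem isPartition_parts {S : Finset ℕ} (π : Finpartition S) : IsPartition π.parts S :=
  ⟨fun _ hb => ⟨π.nonempty_of_mem_parts hb, π.subset hb⟩, fun _ hx => π.exists_mem hx,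
    fun _ hb _ hc _ hx hx' => π.eq_of_mem_parts hb hc hx hx'⟩

theorem sum_partitionsOf (S : Finset ℕ) (g : Finset (Finset ℕ) → ℝ) :
    ∑ P ∈ partitionsOf S, g P = ∑ π : Finpartition S, g π.parts := by
  symm
  refine Finset.sum_bij (fun π _ => π.parts) ?_ ?_ ?_ ?_
  · exact fun π _ => mem_partitionsOf.2 (isPartition_parts π)
  · exact fun π _ σ _ h => Finpartition.ext h
  · intro P hP
    rw [mem_partitionsOf] at hP
    refine ⟨⟨P, ?_, hP.sup_eq, fun h => ?_⟩, Finset.mem_univ _, rfl⟩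
    · rw [Finset.supIndep_iff_pairwiseDisjoint]
      intro b hb c hc hbc
      exact Finset.disjoint_left.2 fun x hx hx' => hbc (hP.2.2 b hb c hc x hx hx')
    · exact Finset.not_nonempty_empty (hP.1 _ h).1
  · exact fun _ _ => rfl

theorem isNoncrossing_iff {S : Finset ℕ} (π : Finpartition S) :
    IsNoncrossing π ↔ edgesIn crossGraph π.parts = ∅ := by
  rw [edgesIn_eq_empty_iff]
  exact forall₄_congr fun b _ c _ => ⟨fun h h' => h h'.1 h'.2, fun h h1 h2 => h ⟨h1, h2⟩⟩

theorem noncrossingSum_Icc (lam : ℝ) (n : ℕ) :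
    noncrossingSum lam (Finset.Icc 1 n) = freePoissonMoment lam n := by
  classical
  rw [noncrossingSum, sum_partitionsOf, freePoissonMoment, momentOfFreeCumulants,
    Finset.sum_filter]
  refine Finset.sum_congr rfl fun π _ => ?_
  rw [edgeSum_eq, Finset.prod_const]
  simp only [isNoncrossing_iff, mul_ite, mul_one, mul_zero]

theorem noncrossingSum_eq_freePoissonMoment (lam : ℝ) (S : Finset ℕ) :
    noncrossingSum lam S = freePoissonMoment lam S.card := by
  rw [← noncrossingSum_Icc]
  exact noncrossingSum_eq_of_card_eq lam (by simp)

theorem noncrossingSum_empty (lam : ℝ) : noncrossingSum lam ∅ = 1 := by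
  have : partitionsOf ∅ = {∅} := by
    ext P
    rw [mem_partitionsOf, Finset.mem_singleton]
    constructor
    · intro h
      refine Finset.eq_empty_of_forall_notMem fun b hb => ?_
      obtain ⟨x, hx⟩ := (h.1 b hb).1
      exact Finset.notMem_empty x ((h.1 b hb).2 hx)
    · rintro rfl
      simp [IsPartition]
  simp [noncrossingSum, this, edgeSum, edgesIn]

theorem freePoissonMoment_zero (lam : ℝ) : freePoissonMoment lam 0 = 1 := by
  have := noncrossingSum_eq_freePoissonMoment lam ∅
  rw [noncrossingSum_empty, Finset.card_empty] at this
  exact this.symm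

theorem classicalCumulant_freePoissonMoment (lam : ℝ) {n : ℕ} (hn : 1 ≤ n) :
    classicalCumulant (freePoissonMoment lam) n = connectedSum lam (Finset.Icc 1 n) := by
  rw [connectedSum_eq_classicalCumulant lam _ (freePoissonMoment_zero lam)
    (noncrossingSum_eq_freePoissonMoment lam) _ (Finset.nonempty_Icc.2 hn), Nat.card_Icc,
    Nat.add_sub_cancel]

/-! ### Connected partitions and connected crossing graphs -/

/-- A block that does not cross `D` lies on one side of any two elements of `D`. -/
theorem forall_mem_Ioo_of_not_blocksCross {b D : Finset ℕ} {d d' : ℕ} (hd : d ∈ D) (hd' : d' ∈ D)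
    (hbD : Disjoint b D) (hcross : ¬ BlocksCross b D) (h : ∃ x ∈ b, d < x ∧ x < d') :
    ∀ x ∈ b, d < x ∧ x < d' := by
  obtain ⟨e, he, hde, hed⟩ := h
  intro u hu
  by_contra hcon
  have h1 : u ≠ d := fun h => Finset.disjoint_left.1 hbD hu (h ▸ hd)
  have h2 : u ≠ d' := fun h => Finset.disjoint_left.1 hbD hu (h ▸ hd')
  rcases Nat.lt_or_ge d u with h3 | h3
  · exact hcross ⟨d, e, d', u, hde, hed, by omega, Or.inr ⟨hd, hd', he, hu⟩⟩
  · exact hcross ⟨u, d, e, d', by omega, hde, hed, Or.inl ⟨hu, he, hd, hd'⟩⟩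

/-- A crossing places a point of `c` between two points of `b`. Confinement to an interval thus
passes along edges of the crossing graph. -/
theorem BlocksCross.exists_mem_Ioo {b c : Finset ℕ} {d d' : ℕ} (hbc : BlocksCross b c)
    (h : ∀ x ∈ b, d < x ∧ x < d') : ∃ x ∈ c, d < x ∧ x < d' := by
  obtain ⟨i, k, j, l, h1, h2, h3, ⟨hi, hj, hk, hl⟩ | ⟨hi, hj, hk, hl⟩⟩ := hbc
  · exact ⟨k, hk, (h i hi).1.trans h1, h2.trans (h j hj).2⟩
  · exact ⟨j, hj, (h k hk).1.trans h2, h3.trans (h l hl).2⟩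

/-- The crossing graph of a connected partition is connected. -/
theorem IsConnectedPartition.connected {n : ℕ} {π : SetPartition n} (hn : 1 ≤ n)
    (h : IsConnectedPartition π) : (crossingGraph π).Connected := by
  classical
  have h1 : 1 ∈ Finset.Icc 1 n := Finset.mem_Icc.2 ⟨le_rfl, hn⟩
  obtain ⟨b₀, hb₀, h1b⟩ := π.exists_mem h1
  let v : {b // b ∈ π.parts} := ⟨b₀, hb₀⟩
  by_contra hcon
  have hex : ∃ w, ¬ (crossingGraph π).Reachable v w := by
    by_contra hall
    push Not at hall
    exact hcon ((crossingGraph π).connected_iff_exists_forall_reachable.2 ⟨v, hall⟩)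
  -- `InC y`: the block of `y` is in the component of the block of `1`
  let InC : ℕ → Prop := fun y => ∃ w : {b // b ∈ π.parts},
    y ∈ w.1 ∧ (crossingGraph π).Reachable v w
  have hInC1 : InC 1 := ⟨v, h1b, .rfl⟩
  have hInCiff : ∀ (w : {b // b ∈ π.parts}) y, y ∈ w.1 →
      (InC y ↔ (crossingGraph π).Reachable v w) := by
    intro w y hy
    refine ⟨fun ⟨w', hy', hr⟩ => ?_, fun hr => ⟨w, hy, hr⟩⟩
    have : w' = w := Subtype.ext (π.eq_of_mem_parts w'.2 w.2 hy' hy)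
    rwa [← this]
  have hmem : ∀ (w : {b // b ∈ π.parts}) y, y ∈ w.1 → 1 ≤ y ∧ y ≤ n := fun w y hy =>
    Finset.mem_Icc.1 (π.subset w.2 hy)
  -- If the component of 1 met the gap between `d` and `d'`, all its blocks would be trapped there,
  -- since none of them crosses `D`. But 1 is not greater than `d`.
  have hside : ∀ (D : {b // b ∈ π.parts}), ¬ (crossingGraph π).Reachable v D →
      ∀ d ∈ D.1, ∀ d' ∈ D.1, ∀ y, d < y → y < d' → ¬ InC y := by
    rintro D hD d hd d' hd' y hdy hyd ⟨w, hyw, hr⟩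
    have hstep : ∀ c : {b // b ∈ π.parts}, (crossingGraph π).Reachable v c →
        (∃ x ∈ c.1, d < x ∧ x < d') → ∀ x ∈ c.1, d < x ∧ x < d' := by
      intro c hc hx
      have hne : c ≠ D := fun h => hD (h ▸ hc)
      refine forall_mem_Ioo_of_not_blocksCross hd hd' ?_ ?_ hx
      · exact π.disjoint c.2 D.2 fun h => hne (Subtype.ext h)
      · exact fun hcD =>
          hD (hc.trans (SimpleGraph.Adj.reachable (G := crossingGraph π) ⟨hne, hcD⟩))
    have key := hr.symm.induct (p := fun c : {b // b ∈ π.parts} =>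
      (crossingGraph π).Reachable v c ∧ ∀ x ∈ c.1, d < x ∧ x < d')
      ⟨hr, hstep w hr ⟨y, hyw, hdy, hyd⟩⟩ (by
        rintro b c ⟨hb, hx⟩ hbc
        have hc := hb.trans hbc.reachable
        exact ⟨hc, hstep c hc (hbc.2.exists_mem_Ioo hx)⟩)
    exact absurd (key.2 1 h1b).1 (hmem D d hd).1.not_gt
  have hx : ∃ x, 1 ≤ x ∧ ¬ InC x := by
    obtain ⟨w, hw⟩ := hex
    obtain ⟨x, hx⟩ := π.nonempty_of_mem_parts w.2
    exact ⟨x, (hmem w x hx).1, fun hc => hw ((hInCiff w x hx).1 hc)⟩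
  have hxn : Nat.find hx ≤ n := by
    obtain ⟨w, hw⟩ := hex
    obtain ⟨x, hx'⟩ := π.nonempty_of_mem_parts w.2
    exact (Nat.find_min' hx ⟨(hmem w x hx').1, fun hc => hw ((hInCiff w x hx').1 hc)⟩).trans
      (hmem w x hx').2
  obtain ⟨hx1, hxC⟩ := Nat.find_spec hx
  have hxmin : ∀ y, 1 ≤ y → y < Nat.find hx → InC y := by
    intro y hy hlt
    by_contra hc
    exact Nat.find_min hx hlt ⟨hy, hc⟩
  generalize Nat.find hx = x at hxn hx1 hxC hxmin
  have hx2 : 2 ≤ x := by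
    rcases hx1.eq_or_lt with h | h
    · exact absurd (h ▸ hInC1) hxC
    · exact h
  -- With `x` the least point outside the component of 1 and `z` the next point of that component
  -- (or `n + 1`), the interval from `x` to `z - 1` will be a union of blocks, contradicting
  -- connectedness.
  have hz : ∃ z, x < z ∧ (InC z ∨ z = n + 1) := ⟨n + 1, by omega, Or.inr rfl⟩
  have hzn : Nat.find hz ≤ n + 1 := Nat.find_min' hz ⟨by omega, Or.inr rfl⟩
  obtain ⟨hxz, hzC⟩ := Nat.find_spec hz
  have hzmin : ∀ y, x < y → y < Nat.find hz → ¬ InC y := fun y hy hlt hc =>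
    Nat.find_min hz hlt ⟨hy, Or.inl hc⟩
  generalize Nat.find hz = z at hzn hxz hzC hzmin
  refine h x (z - 1) hx1 (by omega) (by omega) ?_
    ⟨π.parts.filter (· ⊆ Finset.Icc x (z - 1)), Finset.filter_subset _ _, ?_⟩
  · intro heq
    have := heq ▸ h1
    rw [Finset.mem_Icc] at this
    omega
  · refine le_antisymm (Finset.sup_le fun b hb => (Finset.mem_filter.1 hb).2) fun y hy => ?_
    have hy' := Finset.mem_Icc.1 hy
    have hyC : ¬ InC y := by
      rcases hy'.1.eq_or_lt with h | h
      · exact h ▸ hxC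
      · exact hzmin y h (by omega)
    obtain ⟨b, hb, hyb⟩ := π.exists_mem (Finset.mem_Icc.2 ⟨hx1.trans hy'.1, by omega⟩ :
      y ∈ Finset.Icc 1 n)
    let D : {b // b ∈ π.parts} := ⟨b, hb⟩
    have hD : ¬ (crossingGraph π).Reachable v D := mt (hInCiff D y hyb).2 hyC
    refine Finset.mem_sup.2 ⟨b, Finset.mem_filter.2 ⟨hb, fun d hd => ?_⟩, hyb⟩
    have hd1 := hmem D d hd
    have hdC : ¬ InC d := mt (hInCiff D d hd).1 hD
    -- A point `d` of the block below `x` would be in the component by minimality of `x`; if it is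
    -- beyond the interval, then `z` lies between `y` and `d`, which `hside` forbids.
    by_contra hcon
    rw [Finset.mem_Icc] at hcon
    rcases Nat.lt_or_ge d x with hlt | hge
    · exact hdC (hxmin d hd1.1 hlt)
    · have hzd : z ≤ d := by omega
      have hzC' : InC z := hzC.resolve_right (by omega)
      have hne : z ≠ d := fun h => hdC (h ▸ hzC')
      exact hside D hD y hyb d hd z (by omega) (by omega) hzC'

/-- In a crossing, each of the two sets has a point between two points of the other, and an interval
contains everything between its points. -/
theorem not_blocksCross_of_subset_Icc {a b : ℕ} {c d : Finset ℕ} (hc : c ⊆ Finset.Icc a b)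
    (hd : Disjoint d (Finset.Icc a b)) : ¬ BlocksCross c d := by
  have hc' : ∀ x ∈ c, a ≤ x ∧ x ≤ b := fun x hx => Finset.mem_Icc.1 (hc hx)
  have hd' : ∀ x ∈ d, ¬ (a ≤ x ∧ x ≤ b) := fun x hx h =>
    Finset.disjoint_left.1 hd hx (Finset.mem_Icc.2 h)
  rintro ⟨i, k, j, l, h1, h2, h3, ⟨hi, hj, hk, hl⟩ | ⟨hi, hj, hk, hl⟩⟩
  · exact hd' k hk ⟨(hc' i hi).1.trans h1.le, h2.le.trans (hc' j hj).2⟩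
  · exact hd' j hj ⟨(hc' k hk).1.trans h2.le, h3.le.trans (hc' l hl).2⟩

/-- Partitions that are not connected do not contribute. -/
theorem connSum_parts_eq_zero {n : ℕ} {π : SetPartition n} (h : ¬ IsConnectedPartition π) :
    connSum crossGraph π.parts = 0 := by
  classical
  unfold IsConnectedPartition at h
  push Not at h
  obtain ⟨a, b, ha, hab, hb, hne, U, hU, hsup⟩ := h
  have hP := isPartition_parts π
  have haI : a ∈ U.sup id := hsup ▸ Finset.left_mem_Icc.2 hab
  obtain ⟨c, hc, -⟩ := Finset.mem_sup.1 haI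
  have hex : ∃ y ∈ Finset.Icc 1 n, y ∉ Finset.Icc a b := by
    by_contra hcon
    push Not at hcon
    exact hne (le_antisymm (Finset.Icc_subset_Icc ha hb) hcon)
  obtain ⟨y, hy, hyI⟩ := hex
  obtain ⟨d, hd, hyd⟩ := π.exists_mem hy
  have hdU : d ∉ U := fun h => hyI (hsup ▸ Finset.mem_sup.2 ⟨d, h, hyd⟩)
  refine connSum_eq_zero hU hc (Finset.mem_sdiff.2 ⟨hd, hdU⟩) fun p hp q hq hpq => ?_
  have hq' := Finset.mem_sdiff.1 hq
  refine not_blocksCross_of_subset_Icc (a := a) (b := b) ?_ ?_ hpq.2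
  · exact hsup ▸ Finset.le_sup (f := id) hp
  · rw [← hsup]
    exact Finset.disjoint_left.2 fun x hx hxU => hq'.2 (hP.mem_of_mem_sup hU hq'.1 hx hxU)

/-! ### The cumulant formula -/

theorem connSum_parts_eq_tutteEval {n : ℕ} {π : SetPartition n} (hn : 1 ≤ n)
    (h : IsConnectedPartition π) :
    connSum crossGraph π.parts =
      -((-1) ^ π.parts.card * tutteEval (crossingGraph π) 1 0) := by
  classical
  have h1 := connSum_map_univ (G := crossGraph) (crossingGraph π) (Function.Embedding.subtype _)
    fun x y => ⟨fun h => ⟨fun he => h.1 (Subtype.ext he), h.2⟩,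
      fun h => ⟨fun he => h.1 (congrArg _ he), h.2⟩⟩
  have h2 : (Finset.univ : Finset {b // b ∈ π.parts}).map (Function.Embedding.subtype _) =
      π.parts := by
    ext b
    simp
  rw [h2] at h1
  rw [tutteEval_one_zero _ (h.connected hn), ← h1, Fintype.card_coe]
  have hsq : ((-1 : ℝ) ^ π.parts.card) * (-1) ^ π.parts.card = 1 := by
    rw [← mul_pow]; simp
  linear_combination (-connSum crossGraph π.parts) * hsq

open Classical in
theorem classicalCumulant_freePoissonMoment_eq_sum_tutteEval (lam : ℝ) {n : ℕ} (hn : 1 ≤ n) :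
    classicalCumulant (freePoissonMoment lam) n =
      - ∑ π : SetPartition n with IsConnectedPartition π,
          (-lam) ^ π.parts.card * tutteEval (crossingGraph π) 1 0 := by
  rw [classicalCumulant_freePoissonMoment lam hn, connectedSum, sum_partitionsOf,
    Finset.sum_filter, ← Finset.sum_neg_distrib]
  refine Finset.sum_congr rfl fun π _ => ?_
  split_ifs with h
  · rw [connSum_parts_eq_tutteEval hn h, neg_pow lam]
    ring
  · rw [connSum_parts_eq_zero h, mul_zero, neg_zero]

open Classical in
theorem theorem7p1 (lam : ℝ) (hlam : 0 < lam) :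
    (∀ n : ℕ, 1 ≤ n →
      classicalCumulant (freePoissonMoment lam) n =
        - ∑ π : SetPartition n with IsConnectedPartition π,
            (-lam) ^ π.parts.card * tutteEval (crossingGraph π) 1 0) ∧
    (∀ μ : Measure ℝ, IsFreePoisson lam μ → ∀ n : ℕ, 1 ≤ n →
      classicalCumulant (fun k => ∫ x, x ^ k ∂μ) n =
        - ∑ π : SetPartition n with IsConnectedPartition π,
            (-lam) ^ π.parts.card * tutteEval (crossingGraph π) 1 0) := by
  refine ⟨fun n hn => classicalCumulant_freePoissonMoment_eq_sum_tutteEval lam hn,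
    fun μ hμ n hn => ?_⟩
  rw [show (fun k => ∫ x, x ^ k ∂μ) = freePoissonMoment lam from funext hμ.hasFreeCumulants]
  exact classicalCumulant_freePoissonMoment_eq_sum_tutteEval lam hn
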